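/- A probability distribution on $\mathbb{R}_{\ge 0}$ with cumulative distribution function $F$ is called \emph{regular} if on the interval $\{v : 0<F(v)<1\}$ it has a positive density $f$ for which the virtual value $v-\frac{1-F(v)}{f(v)}$ is non-decreasing there (so an atom is allowed only at the maximum of the support). Let $n$ bidders have values $v_1,\dots,v_n$ with regular, possibly nonidentical, marginal distributions $D_1,\dots,D_n$ on $\mathbb{R}_{\ge 0}$. For $r\ge 0$, the second-price auction with anonymous reserve $r$ sells the item to a highest bidder if the highest bid is at least $r$, at a price equal to the maximum of $r$ and the highest of the other bids; otherwise nothing is sold and the revenue is $0$. For a joint distribution $\mathbf{F}$ of $(v_1,\dots,v_n)$, let $\mathrm{AR}(r;\mathbf{F})\in[0,\infty]$ be the expected revenue of this auction when the bids are $(v_1,\dots,v_n)\sim\mathbf{F}$. Theorem. For every $n$, every reserve price $r\ge 0$ and all regular marginals $D_1,\dots,D_n$, the second-price auction with anonymous reserve $r$ is pairwise-robust with constant $18.07$: for every joint distribution $\mathbf{F}$ with marginals $D_1,\dots,D_n$ under which $v_1,\dots,v_n$ are pairwise independent, $$18.07\cdot \mathrm{AR}(r;\mathbf{F})\;\ge\;\mathrm{AR}\Bigl(r;\prod_{i=1}^n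 D_i\Bigr).$$ -/

import Mathlib

open MeasureTheory ProbabilityTheory
open scoped ENNReal NNReal

noncomputable section

/-- The points `v` at which the cumulative distribution function `F(v) = Pr[V ≤ v]` lies strictly
between `0` and `1`. Below this interval `F = 0`; above it `F = 1`. -/
def interiorSupport (μ : Measure ℝ) : Set ℝ :=
  {v | 0 < cdf μ v ∧ cdf μ v < 1}

/-- The virtual value `φ(v) = v - (1 - F(v)) / f(v)` of a distribution with cumulative distribution
function `F` and density `f`. -/
def virtualValue (μ : Measure ℝ) (f : ℝ → ℝ) (v : ℝ) : ℝ :=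
  v - (1 - cdf μ v) / f v

/-- `μ` is a regular distribution: on the interval where `0 < F < 1` it has a positive density `f`,
and the virtual value `v - (1 - F(v)) / f(v)` is (weakly) increasing there.

The only mass outside this interval is a possible atom at the maximum of the support (as for
truncated equal-revenue distributions, and for point masses, where the interval is empty). -/
def IsRegularDistribution (μ : Measure ℝ) : Prop :=
  ∃ f : ℝ → ℝ, Measurable f ∧
    (∀ v ∈ interiorSupport μ, 0 < f v) ∧
    μ.restrict (interiorSupport μ) =
      (volume.restrict (interiorSupport μ)).withDensity (fun v => ENNReal.ofReal (f v)) ∧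
    MonotoneOn (virtualValue μ f) (interiorSupport μ)

/-- The family of pairwise independent joint priors with marginals `D i`. -/
def pairwiseIndepPriors {n : ℕ} (D : Fin n → Measure ℝ) : Set (Measure (Fin n → ℝ)) :=
  {F | IsProbabilityMeasure F ∧ (∀ i, F.map (fun v => v i) = D i) ∧
    ∀ i j, i ≠ j → IndepFun (fun v : Fin n → ℝ => v i) (fun v => v j) F}

/-- The expected revenue `𝔼_{v ∼ F} [∑ i, pay v i]` of an auction with non-negative payments. -/
def expectedRevenue {n : ℕ} (pay : (Fin n → ℝ) → Fin n → ℝ) (F : Measure (Fin n → ℝ)) : ℝ≥0∞ :=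
  ∫⁻ v, ENNReal.ofReal (∑ i, pay v i) ∂F

/-- For the marginals `D`, the auction with payment rule `pay` is pairwise-robust with constant `c`:
`c · M(F) ≥ M(∏ i, D i)` for every pairwise independent prior `F` with marginals `D`. -/
def IsPairwiseRobustWith {n : ℕ} (D : Fin n → Measure ℝ) (pay : (Fin n → ℝ) → Fin n → ℝ)
    (c : ℝ≥0) : Prop :=
  ∀ F ∈ pairwiseIndepPriors D,
    expectedRevenue pay (Measure.pi D) ≤ (c : ℝ≥0∞) * expectedRevenue pay F

/-- In the second-price auction with reserve `r`, bidder `i` wins: the bid meets the reserve and is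
the highest one. Ties are broken in favour of the smallest index (the revenue does not depend on
how they are broken). -/
def arWins {n : ℕ} (r : ℝ) (b : Fin n → ℝ) (i : Fin n) : Prop :=
  r ≤ b i ∧ ∀ j, b j < b i ∨ (b j = b i ∧ i ≤ j)

open Classical in
/-- Payments in the second-price auction with anonymous reserve `r`: the winner pays the maximum of
`r` and the other bids, everybody else pays nothing. -/
def arPayment {n : ℕ} (r : ℝ) (b : Fin n → ℝ) (i : Fin n) : ℝ :=
  if arWins r b i then (Finset.univ.erase i).fold max r b else 0

end

/-! The revenue equals `r` times the probability that some value reaches `r`, plus the integral over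
`t > r` of the probability that two values exceed `t` (`expectedRevenue_arPayment`). Two pairwise
independent priors `F`, `G` with the same marginals are compared level by level; the product measure
is one choice of `G`.

High levels: regularity makes `t (1 - F(t)) / F(t)` non-increasing, so once all tails at `T` are at
most `1/2` they decay like `2T/(T+t)`. Two values exceed `t` with probability at most half of
`tailPairs`, and integrating gives at most `T · tailPairs D T` beyond `T`
(`lintegral_atLeastTwo_tail_le`).

Low levels: let `T` be the least level at or above `r` with `SmallTail`. Since `T = r + (T - r)`,
the cost of the high levels is spread as a constant `tailPairs D T` over the reserve term and over
every `t` in `(r, T)`. It remains to show, at each such level, that the `G`-probability plus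
`tailPairs D T` is at most `18` times the `F`-probability (`measureReal_atLeastTwo_add_le`,
`one_add_tailPairs_le`; `SmallTail.measureReal_iUnion_add_le` when `T = r`). The lower bounds on `F`
are second-moment bounds on the number of values above `t`, which see only pairwise independence. -/

/-! ### Regular distributions: revenue curve and tail decay. -/

theorem measureReal_Ioc_eq_cdf_sub (μ : Measure ℝ) [IsProbabilityMeasure μ] {s t : ℝ} (h : s ≤ t) :
    μ.real (Set.Ioc s t) = cdf μ t - cdf μ s := by
  have hset : Set.Ioc s t = Set.Iic t \ Set.Iic s := by
    ext x
    simp [and_comm]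
  rw [cdf_eq_real, cdf_eq_real, hset,
    measureReal_sdiff (Set.Iic_subset_Iic.2 h) measurableSet_Iic]

/-- Integration by parts without a density: layer-cake formula for `x - s`. -/
theorem integral_Ioc_id_eq (μ : Measure ℝ) [IsProbabilityMeasure μ] {s t : ℝ} (h : s ≤ t) :
    ∫ x in Set.Ioc s t, x ∂μ =
      s * (1 - cdf μ s) - t * (1 - cdf μ t) + ∫ x in s..t, (1 - cdf μ x) := by
  have hid : IntegrableOn (fun x : ℝ => x) (Set.Ioc s t) μ :=
    (continuous_id.continuousOn.integrableOn_Icc).mono_set Set.Ioc_subset_Icc_self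
  have hsub : IntegrableOn (fun x : ℝ => x - s) (Set.Ioc s t) μ := hid.sub (integrable_const s)
  have hF : IntervalIntegrable (fun x => cdf μ x) volume s t :=
    (monotone_cdf μ).intervalIntegrable
  have key : ∫ x in Set.Ioc s t, (x - s) ∂μ = ∫ x in s..t, (cdf μ t - cdf μ x) := by
    rw [hsub.integral_eq_integral_meas_lt
      ((ae_restrict_iff' measurableSet_Ioc).2 (Filter.Eventually.of_forall fun x hx => by
        simpa using hx.1.le))]
    have h1 : ∀ y ∈ Set.Ioi (0 : ℝ), (μ.restrict (Set.Ioc s t)).real {a | y < a - s} =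
        (Set.Ioc 0 (t - s)).indicator (fun y => cdf μ t - cdf μ (s + y)) y := by
      intro y hy
      have hset : {a | y < a - s} ∩ Set.Ioc s t = Set.Ioc (s + y) t := by
        ext a
        simp only [Set.mem_inter_iff, Set.mem_ofPred_eq, Set.mem_Ioc]
        rw [Set.mem_Ioi] at hy
        constructor
        · rintro ⟨h1, h2, h3⟩; exact ⟨by linarith, h3⟩
        · rintro ⟨h1, h2⟩; exact ⟨by linarith, by linarith, h2⟩
      have hmeas : MeasurableSet {a | y < a - s} :=
        measurableSet_lt measurable_const (by fun_prop)
      rw [measureReal_restrict_apply hmeas, hset]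
      by_cases hyt : y ≤ t - s
      · rw [Set.indicator_of_mem (show y ∈ Set.Ioc 0 (t - s) from ⟨hy, hyt⟩),
          measureReal_Ioc_eq_cdf_sub μ (by linarith)]
      · rw [Set.indicator_of_notMem (fun hm => hyt hm.2), Set.Ioc_eq_empty (by linarith)]
        simp
    rw [setIntegral_congr_fun measurableSet_Ioi h1, setIntegral_indicator measurableSet_Ioc,
      Set.inter_eq_right.2 Set.Ioc_subset_Ioi_self,
      ← intervalIntegral.integral_of_le (by linarith),
      intervalIntegral.integral_comp_add_left (fun y => cdf μ t - cdf μ y) s]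
    simp
  have h2 : ∫ x in Set.Ioc s t, (x - s) ∂μ =
      ∫ x in Set.Ioc s t, x ∂μ - (cdf μ t - cdf μ s) * s := by
    rw [integral_sub hid (integrable_const s), setIntegral_const,
      measureReal_Ioc_eq_cdf_sub μ h, smul_eq_mul]
  rw [intervalIntegral.integral_sub intervalIntegrable_const hF,
    intervalIntegral.integral_const, smul_eq_mul, h2] at key
  rw [intervalIntegral.integral_sub intervalIntegrable_const hF,
    intervalIntegral.integral_const, smul_eq_mul]
  linarith

theorem ordConnected_interiorSupport (μ : Measure ℝ) : (interiorSupport μ).OrdConnected :=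
  ⟨fun _ hx _ hy _ hz => ⟨hx.1.trans_le (monotone_cdf μ hz.1), (monotone_cdf μ hz.2).trans_lt hy.2⟩⟩

section Density

variable {μ : Measure ℝ} [IsProbabilityMeasure μ] {f : ℝ → ℝ}

/-- The density cancels in `(1 - F)/f dμ = (1 - F) dx`, which is the boundary-free term of the
integration by parts. Hence virtual values are slopes of the revenue curve `v (1 - F(v))` as a
function of `F`, and regularity is its concavity. -/
theorem integral_virtualValue (hf : Measurable f) (hpos : ∀ v ∈ interiorSupport μ, 0 < f v)
    (hμ : μ.restrict (interiorSupport μ) =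
      (volume.restrict (interiorSupport μ)).withDensity (fun v => ENNReal.ofReal (f v)))
    {s t : ℝ} (hst : s ≤ t) (hs : s ∈ interiorSupport μ) (ht : t ∈ interiorSupport μ) :
    IntegrableOn (virtualValue μ f) (Set.Ioc s t) μ ∧
      ∫ x in Set.Ioc s t, virtualValue μ f x ∂μ =
        s * (1 - cdf μ s) - t * (1 - cdf μ t) := by
  have hsub : Set.Ioc s t ⊆ interiorSupport μ := Set.Ioc_subset_Icc_self.trans
    ((ordConnected_interiorSupport μ).out hs ht)
  have hμ' : μ.restrict (Set.Ioc s t) =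
      (volume.restrict (Set.Ioc s t)).withDensity (fun v => ENNReal.ofReal (f v)) := by
    have := congrArg (fun ν : Measure ℝ => ν.restrict (Set.Ioc s t)) hμ
    rwa [Measure.restrict_restrict measurableSet_Ioc, restrict_withDensity measurableSet_Ioc,
      Measure.restrict_restrict measurableSet_Ioc, Set.inter_eq_left.2 hsub] at this
  have hid : IntegrableOn (fun x : ℝ => x) (Set.Ioc s t) μ :=
    (continuous_id.continuousOn.integrableOn_Icc).mono_set Set.Ioc_subset_Icc_self
  have hF : IntervalIntegrable (fun x => 1 - cdf μ x) volume s t :=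
    intervalIntegrable_const.sub (monotone_cdf μ).intervalIntegrable
  have hcongr : ∀ x ∈ Set.Ioc s t,
      (ENNReal.ofReal (f x)).toReal • ((1 - cdf μ x) / f x) = 1 - cdf μ x := by
    intro x hx
    have := hpos x (hsub hx)
    rw [ENNReal.toReal_ofReal this.le, smul_eq_mul]
    field_simp
  have hq : IntegrableOn (fun x => (1 - cdf μ x) / f x) (Set.Ioc s t) μ := by
    rw [IntegrableOn, hμ', integrable_withDensity_iff_integrable_smul' (by fun_prop) (by simp)]
    exact (integrableOn_congr_fun hcongr measurableSet_Ioc).2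
      ((intervalIntegrable_iff_integrableOn_Ioc_of_le hst).1 hF)
  have hqi : ∫ x in Set.Ioc s t, (1 - cdf μ x) / f x ∂μ = ∫ x in s..t, (1 - cdf μ x) := by
    rw [hμ', integral_withDensity_eq_integral_toReal_smul (by fun_prop) (by simp),
      setIntegral_congr_fun measurableSet_Ioc hcongr, intervalIntegral.integral_of_le hst]
  refine ⟨hid.sub hq, ?_⟩
  have : ∫ x in Set.Ioc s t, virtualValue μ f x ∂μ =
      ∫ x in Set.Ioc s t, x ∂μ - ∫ x in Set.Ioc s t, (1 - cdf μ x) / f x ∂μ :=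
    integral_sub hid hq
  rw [this, hqi, integral_Ioc_id_eq μ hst]
  ring

theorem continuousAt_cdf_of_singleton {x : ℝ} (hx : μ {x} = 0) : ContinuousAt (cdf μ) x := by
  rw [(monotone_cdf μ).continuousAt_iff_leftLim_eq_rightLim, (cdf μ).rightLim_eq]
  have h := (cdf μ).measure_singleton x
  rw [measure_cdf, hx, eq_comm, ENNReal.ofReal_eq_zero] at h
  exact le_antisymm ((monotone_cdf μ).leftLim_le le_rfl) (by linarith)

theorem continuousAt_cdf_of_lt_one
    (hμ : μ.restrict (interiorSupport μ) =
      (volume.restrict (interiorSupport μ)).withDensity (fun v => ENNReal.ofReal (f v)))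
    {x : ℝ} (hx : cdf μ x < 1) : ContinuousAt (cdf μ) x := by
  apply continuousAt_cdf_of_singleton
  rcases (cdf_nonneg μ x).eq_or_lt with h0 | h0
  · rw [cdf_eq_real, eq_comm, measureReal_eq_zero_iff] at h0
    exact measure_mono_null (by simp) h0
  · have hsub : {x} ⊆ interiorSupport μ := by
      rintro _ rfl
      exact ⟨h0, hx⟩
    have h1 : μ.restrict (interiorSupport μ) {x} = 0 := by
      rw [hμ]
      exact withDensity_absolutelyContinuous _ _ (by simp)
    rwa [Measure.restrict_apply (measurableSet_singleton x), Set.inter_eq_left.2 hsub] at h1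

end Density

theorem cdf_eq_zero_of_neg {μ : Measure ℝ} [IsProbabilityMeasure μ] (h : ∀ᵐ v ∂μ, 0 ≤ v) {x : ℝ}
    (hx : x < 0) : cdf μ x = 0 := by
  rw [cdf_eq_real, measureReal_eq_zero_iff]
  refine measure_mono_null ?_ h
  intro y hy
  simp only [Set.mem_compl_iff, Set.mem_ofPred_eq, not_le]
  exact lt_of_le_of_lt hy hx

/-- For a regular distribution, `t` times the odds `(1 - F(t)) / F(t)` is non-increasing. -/
theorem IsRegularDistribution.mul_odds_antitone {μ : Measure ℝ} [IsProbabilityMeasure μ]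
    (h0 : ∀ᵐ v ∂μ, 0 ≤ v) (h : IsRegularDistribution μ) {p t : ℝ} (hp : 0 ≤ p) (hpt : p ≤ t) :
    t * (1 - cdf μ t) * cdf μ p ≤ p * (1 - cdf μ p) * cdf μ t := by
  obtain ⟨f, hf, hpos, hμ, hmono⟩ := h
  have hFle := monotone_cdf μ hpt
  have h2 := cdf_le_one μ t
  have h3 := cdf_nonneg μ p
  have hRp : 0 ≤ p * (1 - cdf μ p) := mul_nonneg hp (by linarith)
  rcases h3.eq_or_lt with hz | hz
  · rw [← hz]
    have : 0 ≤ p * 1 * cdf μ t := by have := cdf_nonneg μ t; positivity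
    simpa using this
  rcases h2.eq_or_lt with ho | ho
  · rw [ho]
    simpa using hRp
  have hpI : p ∈ interiorSupport μ := ⟨hz, hFle.trans_lt ho⟩
  have htI : t ∈ interiorSupport μ := ⟨hz.trans_le hFle, ho⟩
  obtain ⟨hi1, he1⟩ := integral_virtualValue hf hpos hμ hpt hpI htI
  have hsub1 : Set.Ioc p t ⊆ interiorSupport μ := Set.Ioc_subset_Icc_self.trans
    ((ordConnected_interiorSupport μ).out hpI htI)
  -- The curve `R(v) = v (1 - F(v))` is concave in `F`: `hA` and `hB` compare its chords on either
  -- side of `p` with the slope at `p`. As `R ≥ 0` down to `F = 0`, the ratio `R/F` is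
  -- non-increasing.
  have hA : virtualValue μ f p * (cdf μ t - cdf μ p) ≤
      p * (1 - cdf μ p) - t * (1 - cdf μ t) := by
    rw [← he1, ← measureReal_Ioc_eq_cdf_sub μ hpt, mul_comm, ← smul_eq_mul, ← setIntegral_const]
    exact setIntegral_mono_on (integrable_const _) hi1 measurableSet_Ioc
      fun x hx => hmono hpI (hsub1 hx) hx.1.le
  have hB : ∀ s ∈ interiorSupport μ, s ≤ p →
      - (p * (1 - cdf μ p)) ≤ virtualValue μ f p * (cdf μ p - cdf μ s) := by
    intro s hs hsp
    obtain ⟨hi2, he2⟩ := integral_virtualValue hf hpos hμ hsp hs hpI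
    have hsub2 : Set.Ioc s p ⊆ interiorSupport μ := Set.Ioc_subset_Icc_self.trans
      ((ordConnected_interiorSupport μ).out hs hpI)
    have hs0 : 0 ≤ s := by
      by_contra hneg
      exact hs.1.ne' (cdf_eq_zero_of_neg h0 (not_le.1 hneg))
    have : s * (1 - cdf μ s) - p * (1 - cdf μ p) ≤
        virtualValue μ f p * (cdf μ p - cdf μ s) := by
      rw [← he2, ← measureReal_Ioc_eq_cdf_sub μ hsp, mul_comm (virtualValue μ f p),
        ← smul_eq_mul, ← setIntegral_const]
      exact setIntegral_mono_on hi2 (integrable_const _) measurableSet_Ioc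
        fun x hx => hmono (hsub2 hx) hpI hx.2
    have := mul_nonneg hs0 (sub_nonneg.2 hs.2.le)
    linarith
  -- Without atoms below the top, `F` takes every value `ε` in `(0, F(p)]`; letting `ε` tend to `0`
  -- gives `hD`.
  have hC : ∀ ε ∈ Set.Ioc 0 (cdf μ p), - (p * (1 - cdf μ p)) ≤
      virtualValue μ f p * (cdf μ p - ε) := by
    intro ε hε
    have hcont : ContinuousOn (cdf μ) (Set.Icc (-1) p) := fun x hx =>
      (continuousAt_cdf_of_lt_one hμ
        ((monotone_cdf μ hx.2).trans_lt hpI.2)).continuousWithinAt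
    obtain ⟨s, hs, rfl⟩ := intermediate_value_Icc (by linarith) hcont
      (show ε ∈ Set.Icc (cdf μ (-1)) (cdf μ p) by
        rw [cdf_eq_zero_of_neg h0 (by norm_num)]; exact ⟨hε.1.le, hε.2⟩)
    exact hB s ⟨hε.1, hε.2.trans_lt hpI.2⟩ hs.2
  have hD : - (p * (1 - cdf μ p)) ≤ virtualValue μ f p * cdf μ p := by
    rcases le_or_gt 0 (virtualValue μ f p) with hv | hv
    · nlinarith [mul_nonneg hv h3]
    · by_contra hcon
      push Not at hcon
      set δ := - (p * (1 - cdf μ p)) - virtualValue μ f p * cdf μ p with hδ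
      have hδ0 : 0 < δ := by linarith
      have hε0 : 0 < min (cdf μ p) (δ / (2 * -virtualValue μ f p)) :=
        lt_min hz (div_pos hδ0 (by linarith))
      have := hC _ ⟨hε0, min_le_left _ _⟩
      have h4 : min (cdf μ p) (δ / (2 * -virtualValue μ f p)) * (2 * -virtualValue μ f p) ≤ δ := by
        rw [← le_div_iff₀ (by linarith)]
        exact min_le_right _ _
      nlinarith
  nlinarith [mul_le_mul_of_nonneg_right hA h3, mul_le_mul_of_nonneg_right hD (sub_nonneg.2 hFle)]

/-- Above a point of upper tail probability at most `1/2`, the tail of a regular distribution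
decays at least like that of the equal-revenue distribution. -/
theorem IsRegularDistribution.tail_le {μ : Measure ℝ} [IsProbabilityMeasure μ]
    (h0 : ∀ᵐ v ∂μ, 0 ≤ v) (h : IsRegularDistribution μ) {p t : ℝ} (hp : 0 ≤ p) (hpt : p < t)
    (hhalf : μ.real (Set.Ioi p) ≤ 1 / 2) :
    μ.real (Set.Ioi t) ≤ 2 * p / (p + t) * μ.real (Set.Ioi p) := by
  have hc : ∀ x, μ.real (Set.Ioi x) = 1 - cdf μ x := fun x => by
    rw [cdf_eq_real, ← Set.compl_Iic, probReal_compl_eq_one_sub measurableSet_Iic]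
  have key := h.mul_odds_antitone h0 hp hpt.le
  have h2 := cdf_le_one μ t
  rw [hc] at hhalf
  rw [hc, hc, div_mul_eq_mul_div, le_div_iff₀ (by linarith)]
  -- With `q` the tail at `p`, monotone odds bound the tail at `t` by `p q / (t - (t - p) q)`, and
  -- `q ≤ 1/2` makes this denominator at least `(p + t)/2`.
  nlinarith [mul_nonneg (sub_nonneg.2 h2) (mul_nonneg (sub_nonneg.2 hpt.le)
    (show 0 ≤ cdf μ p - 1 / 2 by linarith))]

/-! ### Second-moment bounds for pairwise independent events. -/

/-- The event that at least two of the events `A i` occur. -/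
def atLeastTwo {Ω ι : Type*} (A : ι → Set Ω) : Set Ω :=
  {ω | ∃ i j, i ≠ j ∧ ω ∈ A i ∧ ω ∈ A j}

open Classical in
/-- The number of the events `A i`, `i ∈ s`, that occur. -/
noncomputable def countOn {Ω ι : Type*} (A : ι → Set Ω) (s : Finset ι) (ω : Ω) : ℕ :=
  (s.filter fun i => ω ∈ A i).card

theorem countOn_eq_sum {Ω ι : Type*} (A : ι → Set Ω) (s : Finset ι) (ω : Ω) :
    (countOn A s ω : ℝ) = ∑ i ∈ s, (A i).indicator 1 ω := by
  classical
  simp [countOn, Set.indicator_apply]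

theorem countOn_sq {Ω ι : Type*} (A : ι → Set Ω) (s : Finset ι) (ω : Ω) :
    (countOn A s ω : ℝ) ^ 2 = ∑ i ∈ s, (A i).indicator 1 ω * (countOn A s ω : ℝ) := by
  rw [← Finset.sum_mul, ← countOn_eq_sum, sq]

theorem countOn_pos {Ω ι : Type*} {A : ι → Set Ω} {s : Finset ι} {ω : Ω} :
    0 < countOn A s ω ↔ ∃ i ∈ s, ω ∈ A i := by
  classical
  simp [countOn, Finset.card_pos, Finset.filter_nonempty_iff]

theorem two_le_countOn_univ {Ω ι : Type*} [Fintype ι] {A : ι → Set Ω} {ω : Ω} :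
    2 ≤ countOn A Finset.univ ω ↔ ω ∈ atLeastTwo A := by
  classical
  change 1 < _ ↔ _
  rw [countOn, Finset.one_lt_card]
  simp only [Finset.mem_filter, Finset.mem_univ, true_and, atLeastTwo, Set.mem_ofPred_eq]
  constructor
  · rintro ⟨i, hi, j, hj, hij⟩
    exact ⟨i, j, hij, hi, hj⟩
  · rintro ⟨i, j, hij, hi, hj⟩
    exact ⟨i, hi, j, hj, hij⟩

theorem measurableSet_atLeastTwo {Ω ι : Type*} [MeasurableSpace Ω] [Fintype ι] {A : ι → Set Ω}
    (hA : ∀ i, MeasurableSet (A i)) : MeasurableSet (atLeastTwo A) := by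
  have : atLeastTwo A = ⋃ i, ⋃ j, ⋃ (_ : i ≠ j), A i ∩ A j := by
    ext ω
    simp only [atLeastTwo, Set.mem_ofPred_eq, Set.mem_iUnion, Set.mem_inter_iff, exists_prop]
  rw [this]
  exact MeasurableSet.iUnion fun i => MeasurableSet.iUnion fun j => MeasurableSet.iUnion fun _ =>
    (hA i).inter (hA j)

section Pairwise

variable {Ω ι : Type*} [MeasurableSpace Ω] {P : Measure Ω} [IsProbabilityMeasure P]
  {A : ι → Set Ω}

theorem integrable_countOn (hA : ∀ i, MeasurableSet (A i)) (s : Finset ι) :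
    Integrable (fun ω => (countOn A s ω : ℝ)) P := by
  simp only [countOn_eq_sum]
  exact integrable_finsetSum _ fun i _ => (integrable_const 1).indicator (hA i)

theorem integral_countOn (hA : ∀ i, MeasurableSet (A i)) (s : Finset ι) :
    ∫ ω, (countOn A s ω : ℝ) ∂P = ∑ i ∈ s, P.real (A i) := by
  simp only [countOn_eq_sum]
  rw [integral_finsetSum _ fun i _ => (integrable_const 1).indicator (hA i)]
  exact Finset.sum_congr rfl fun i _ => integral_indicator_one (hA i)

theorem integrable_indicator_mul_countOn (hA : ∀ i, MeasurableSet (A i)) (i : ι) (s : Finset ι) :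
    Integrable (fun ω => (A i).indicator 1 ω * (countOn A s ω : ℝ)) P := by
  have : (fun ω => (A i).indicator 1 ω * (countOn A s ω : ℝ)) =
      (A i).indicator fun ω => (countOn A s ω : ℝ) := by
    ext ω
    by_cases h : ω ∈ A i <;> simp [h]
  rw [this]
  exact (integrable_countOn hA s).indicator (hA i)

theorem integral_indicator_mul_countOn (hA : ∀ i, MeasurableSet (A i)) (i : ι) (s : Finset ι) :
    ∫ ω, (A i).indicator 1 ω * (countOn A s ω : ℝ) ∂P = ∑ j ∈ s, P.real (A i ∩ A j) := by
  have : ∀ ω, (A i).indicator 1 ω * (countOn A s ω : ℝ) =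
      (countOn (fun j => A i ∩ A j) s ω : ℝ) := by
    intro ω
    rw [countOn_eq_sum, countOn_eq_sum, Finset.mul_sum]
    refine Finset.sum_congr rfl fun j _ => ?_
    rw [Set.inter_indicator_one, Pi.mul_apply]
  simp only [this]
  exact integral_countOn (fun j => (hA i).inter (hA j)) s

theorem integrable_countOn_sq (hA : ∀ i, MeasurableSet (A i)) (s : Finset ι) :
    Integrable (fun ω => (countOn A s ω : ℝ) ^ 2) P := by
  simp only [countOn_sq]
  exact integrable_finsetSum _ fun i _ => integrable_indicator_mul_countOn hA i s

theorem integral_countOn_sq (hA : ∀ i, MeasurableSet (A i))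
    (hpair : ∀ i j, i ≠ j → P.real (A i ∩ A j) = P.real (A i) * P.real (A j)) (s : Finset ι) :
    ∫ ω, (countOn A s ω : ℝ) ^ 2 ∂P = ∑ i ∈ s, P.real (A i) * (1 - P.real (A i)) +
      (∑ i ∈ s, P.real (A i)) ^ 2 := by
  classical
  simp only [countOn_sq]
  rw [integral_finsetSum _ fun i _ => integrable_indicator_mul_countOn hA i s, sq, Finset.sum_mul,
    ← Finset.sum_add_distrib]
  refine Finset.sum_congr rfl fun i hi => ?_
  rw [integral_indicator_mul_countOn hA, ← Finset.add_sum_erase _ _ hi,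
    ← Finset.add_sum_erase s (fun i => P.real (A i)) hi, Set.inter_self,
    Finset.sum_congr rfl fun j hj => hpair i j (Finset.ne_of_mem_erase hj).symm, ← Finset.mul_sum]
  ring

/-- The common device for lower bounds: minorize an indicator by a quadratic in the count, whose
mean is determined by pairwise probabilities. -/
theorem integral_le_measureReal {B : Set Ω} (hB : MeasurableSet B) {g : Ω → ℝ}
    (hg : Integrable g P) (h1 : ∀ ω ∈ B, g ω ≤ 1) (h0 : ∀ ω ∉ B, g ω ≤ 0) :
    ∫ ω, g ω ∂P ≤ P.real B := by
  rw [← integral_indicator_one hB]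
  refine integral_mono hg ((integrable_const 1).indicator hB) fun ω => ?_
  by_cases h : ω ∈ B
  · simpa [h] using h1 ω h
  · simpa [h] using h0 ω h

/-- Chung–Erdős inequality for the union of pairwise independent events. -/
theorem sum_le_measureReal_iUnion [Fintype ι] (hA : ∀ i, MeasurableSet (A i))
    (hpair : ∀ i j, i ≠ j → P.real (A i ∩ A j) = P.real (A i) * P.real (A j)) :
    ∑ i, P.real (A i) ≤ P.real (⋃ i, A i) * (1 + ∑ i, P.real (A i)) := by
  set S := ∑ i, P.real (A i) with hS
  have hS0 : 0 ≤ S := Finset.sum_nonneg fun i _ => measureReal_nonneg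
  have hV : ∑ i, P.real (A i) * (1 - P.real (A i)) ≤ S :=
    Finset.sum_le_sum fun i _ => by nlinarith [measureReal_nonneg (μ := P) (s := A i)]
  -- With `N` the count, the minorant is `1 - (cN - 1)²`; this `c` maximizes its mean when the
  -- variance is bounded by `S`.
  set c := 1 / (1 + S) with hc
  have hi1 : Integrable (fun ω => 2 * c * (countOn A Finset.univ ω : ℝ)) P :=
    (integrable_countOn hA _).const_mul _
  have hi2 : Integrable (fun ω => c ^ 2 * (countOn A Finset.univ ω : ℝ) ^ 2) P :=
    (integrable_countOn_sq hA _).const_mul _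
  have key := integral_le_measureReal (P := P) (MeasurableSet.iUnion hA) (hi1.sub hi2)
    (fun ω _ => by
      simp only [Pi.sub_apply]
      nlinarith [sq_nonneg (c * (countOn A Finset.univ ω : ℝ) - 1)])
    (fun ω hω => by
      have : countOn A Finset.univ ω = 0 := by
        by_contra h
        obtain ⟨i, -, hi⟩ := countOn_pos.1 (Nat.pos_of_ne_zero h)
        exact hω (Set.mem_iUnion.2 ⟨i, hi⟩)
      simp [this])
  rw [integral_sub' hi1 hi2, integral_const_mul, integral_const_mul, integral_countOn hA,
    integral_countOn_sq hA hpair, ← hS] at key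
  have hc1 : c * (1 + S) = 1 := by rw [hc]; field_simp
  have h2 : c ^ 2 * (∑ i, P.real (A i) * (1 - P.real (A i)) + S ^ 2) ≤ c * S := by
    calc _ ≤ c ^ 2 * (S + S ^ 2) := by gcongr
      _ = c * S * (c * (1 + S)) := by ring
      _ = c * S := by rw [hc1, mul_one]
  have h3 : c * S ≤ P.real (⋃ i, A i) := by linarith
  calc S = c * S * (1 + S) := by rw [mul_right_comm, hc1, one_mul]
    _ ≤ _ := by gcongr

/-- Cantelli's inequality for the number of occurring events. -/
theorem sq_le_measureReal_atLeastTwo [Fintype ι] (hA : ∀ i, MeasurableSet (A i))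
    (hpair : ∀ i j, i ≠ j → P.real (A i ∩ A j) = P.real (A i) * P.real (A j))
    {V m : ℝ} (hV : ∑ i, P.real (A i) * (1 - P.real (A i)) ≤ V) (hm : 0 < m)
    (hmS : m ≤ ∑ i, P.real (A i) - 1) :
    m ^ 2 ≤ P.real (atLeastTwo A) * (V + m ^ 2) := by
  set S := ∑ i, P.real (A i) with hS
  have hV0 : 0 ≤ V := le_trans (Finset.sum_nonneg fun i _ =>
    mul_nonneg measureReal_nonneg (sub_nonneg.2 measureReal_le_one)) hV
  have hM : 0 < S - 1 := hm.trans_le hmS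
  -- The minorant is `1 - (c(N - 1) - 1)²`, which vanishes at `N = 1` and is non-positive at `N =
  -- 0`; this `c` is optimal for variance `V`.
  set c := (S - 1) / (V + (S - 1) ^ 2) with hc
  have hc0 : 0 ≤ c := by positivity
  have hi1 : Integrable (fun ω => (2 * c + 2 * c ^ 2) * (countOn A Finset.univ ω : ℝ)) P :=
    (integrable_countOn hA _).const_mul _
  have hi2 : Integrable (fun ω => c ^ 2 * (countOn A Finset.univ ω : ℝ) ^ 2) P :=
    (integrable_countOn_sq hA _).const_mul _
  have hi3 : Integrable (fun _ : Ω => 2 * c + c ^ 2) P := integrable_const _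
  have key := integral_le_measureReal (P := P) (measurableSet_atLeastTwo hA)
    ((hi1.sub hi2).sub hi3)
    (fun ω _ => by
      simp only [Pi.sub_apply]
      nlinarith [sq_nonneg (c * ((countOn A Finset.univ ω : ℝ) - 1) - 1)])
    (fun ω hω => by
      rw [← two_le_countOn_univ, not_le] at hω
      simp only [Pi.sub_apply]
      interval_cases countOn A Finset.univ ω <;> push_cast <;> nlinarith)
  rw [integral_sub' (hi1.sub hi2) hi3, integral_sub' hi1 hi2, integral_const_mul,
    integral_const_mul, integral_countOn hA,
    integral_countOn_sq hA hpair, integral_const, ← hS] at key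
  simp only [probReal_univ, one_smul] at key
  have hpos : 0 < V + (S - 1) ^ 2 := by positivity
  have h1 : c * (V + (S - 1) ^ 2) = S - 1 := by rw [hc]; field_simp
  have h2 : c * (S - 1) ≤ P.real (atLeastTwo A) := by
    have : c ^ 2 * (∑ i, P.real (A i) * (1 - P.real (A i))) ≤ c ^ 2 * V := by gcongr
    have : c ^ 2 * (V + (S - 1) ^ 2) = c * (S - 1) := by rw [sq c, mul_assoc, h1]
    nlinarith
  have h3 : (S - 1) ^ 2 ≤ P.real (atLeastTwo A) * (V + (S - 1) ^ 2) := by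
    calc (S - 1) ^ 2 = c * (S - 1) * (V + (S - 1) ^ 2) := by rw [mul_right_comm, h1]; ring
      _ ≤ _ := by gcongr
  have h4 : P.real (atLeastTwo A) ≤ 1 := measureReal_le_one
  nlinarith [mul_nonneg (sub_nonneg.2 h4) (show 0 ≤ (S - 1) ^ 2 - m ^ 2 by nlinarith)]

/-- A bound that stays useful when the expected count is near or below `1`, where Cantelli fails.
With `N` counting the events other than `A i`, the minorant is `2cN - c²N²` on `A i` and `-c²(N² -
N)` off it. -/
theorem mul_le_measureReal_atLeastTwo [Fintype ι] [DecidableEq ι] (hA : ∀ i, MeasurableSet (A i))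
    (hpair : ∀ i j, i ≠ j → P.real (A i ∩ A j) = P.real (A i) * P.real (A j)) (i : ι)
    (hi : 1 / 2 ≤ P.real (A i)) :
    ∑ j ∈ Finset.univ.erase i, P.real (A j) ≤
      P.real (atLeastTwo A) * (2 + 4 * ∑ j ∈ Finset.univ.erase i, P.real (A j)) := by
  set u := ∑ j ∈ Finset.univ.erase i, P.real (A j) with hu
  set q := P.real (A i) with hq
  have hu0 : 0 ≤ u := Finset.sum_nonneg fun i _ => measureReal_nonneg
  -- The maximizer of `2cqu - c²(qu + u²)`, with maximum `q²u/(q + u) ≥ u/(2 + 4u)`.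
  set c := q / (q + u) with hc
  have hc0 : 0 ≤ c := by positivity
  set N : Ω → ℝ := fun ω => (countOn A (Finset.univ.erase i) ω : ℝ) with hN
  have hi1 : Integrable (fun ω => (2 * c - c ^ 2) * ((A i).indicator 1 ω * N ω)) P :=
    (integrable_indicator_mul_countOn hA _ _).const_mul _
  have hi2 : Integrable (fun ω => c ^ 2 * N ω ^ 2) P :=
    (integrable_countOn_sq hA _).const_mul _
  have hi3 : Integrable (fun ω => c ^ 2 * N ω) P :=
    (integrable_countOn hA _).const_mul _
  have hNsq : ∀ ω, N ω ≤ N ω ^ 2 := fun ω => by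
    simp only [hN]
    exact_mod_cast Nat.le_self_pow two_ne_zero _
  have key := integral_le_measureReal (P := P) (measurableSet_atLeastTwo hA)
    ((hi1.sub hi2).add hi3)
    (fun ω _ => by
      simp only [Pi.sub_apply, Pi.add_apply]
      by_cases h : ω ∈ A i
      · simp only [h, Set.indicator_of_mem, Pi.one_apply]
        nlinarith [sq_nonneg (c * N ω - 1)]
      · simp only [h, not_false_eq_true, Set.indicator_of_notMem]
        nlinarith [mul_nonneg (sq_nonneg c) (sub_nonneg.2 (hNsq ω))])
    (fun ω hω => by
      simp only [Pi.sub_apply, Pi.add_apply]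
      by_cases h : ω ∈ A i
      · have : countOn A (Finset.univ.erase i) ω = 0 := by
          by_contra hne
          obtain ⟨j, hj, hj2⟩ := countOn_pos.1 (Nat.pos_of_ne_zero hne)
          exact hω ⟨j, i, Finset.ne_of_mem_erase hj, hj2, h⟩
        simp [hN, this]
      · simp only [h, not_false_eq_true, Set.indicator_of_notMem]
        nlinarith [mul_nonneg (sq_nonneg c) (sub_nonneg.2 (hNsq ω))])
  have hV : ∑ j ∈ Finset.univ.erase i, P.real (A j) * (1 - P.real (A j)) ≤ u :=
    Finset.sum_le_sum fun i _ => by nlinarith [measureReal_nonneg (μ := P) (s := A i)]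
  rw [integral_add' (hi1.sub hi2) hi3, integral_sub' hi1 hi2, integral_const_mul,
    integral_const_mul, integral_const_mul, integral_countOn hA,
    integral_countOn_sq hA hpair, integral_indicator_mul_countOn hA,
    Finset.sum_congr rfl fun j hj => hpair i j (Finset.ne_of_mem_erase hj).symm,
    ← Finset.mul_sum, ← hu, ← hq] at key
  have hqu : 0 < q + u := by linarith
  have h1 : c * (q + u) = q := by rw [hc]; field_simp
  have h2 : c * (q * u) ≤ P.real (atLeastTwo A) := by
    have : c ^ 2 * (∑ j ∈ Finset.univ.erase i, P.real (A j) * (1 - P.real (A j))) ≤ c ^ 2 * u := by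
      gcongr
    have : c ^ 2 * (q * u + u ^ 2) = c * (q * u) := by
      calc _ = c * (c * (q + u)) * u := by ring
        _ = _ := by rw [h1]; ring
    nlinarith
  have h3 : 1 ≤ c * q * (2 + 4 * u) := by
    rw [hc, div_mul_eq_mul_div, div_mul_eq_mul_div, le_div_iff₀ hqu]
    nlinarith [mul_nonneg hu0 (sub_nonneg.2 hi)]
  calc u = u * 1 := (mul_one u).symm
    _ ≤ u * (c * q * (2 + 4 * u)) := by gcongr
    _ = c * (q * u) * (2 + 4 * u) := by ring
    _ ≤ _ := by gcongr

/-- The second factorial moment `N(N - 1)` is at least `2` as soon as two events occur. -/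
theorem two_mul_measureReal_atLeastTwo_le [Fintype ι] (hA : ∀ i, MeasurableSet (A i))
    (hpair : ∀ i j, i ≠ j → P.real (A i ∩ A j) = P.real (A i) * P.real (A j)) :
    2 * P.real (atLeastTwo A) ≤ (∑ i, P.real (A i)) ^ 2 - ∑ i, P.real (A i) ^ 2 := by
  have hB := measurableSet_atLeastTwo hA
  have hi1 := integrable_countOn (P := P) hA Finset.univ
  have hi2 := integrable_countOn_sq (P := P) hA Finset.univ
  have hle : ∀ ω, 2 * (atLeastTwo A).indicator 1 ω ≤
      (countOn A Finset.univ ω : ℝ) ^ 2 - (countOn A Finset.univ ω : ℝ) := by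
    intro ω
    by_cases h : ω ∈ atLeastTwo A
    · have : (2 : ℝ) ≤ countOn A Finset.univ ω := by exact_mod_cast two_le_countOn_univ.2 h
      simp only [h, Set.indicator_of_mem, Pi.one_apply]
      nlinarith
    · simp only [h, not_false_eq_true, Set.indicator_of_notMem, mul_zero, sub_nonneg]
      exact_mod_cast Nat.le_self_pow two_ne_zero _
  have key := integral_mono (μ := P) (((integrable_const 1).indicator hB).const_mul 2)
    (hi2.sub hi1) hle
  have key2 : 2 * P.real (atLeastTwo A) ≤
      ∫ ω, ((countOn A Finset.univ ω : ℝ) ^ 2 - (countOn A Finset.univ ω : ℝ)) ∂P := by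
    rw [← integral_indicator_one hB, ← integral_const_mul]
    exact key
  rw [integral_sub hi2 hi1, integral_countOn hA, integral_countOn_sq hA hpair] at key2
  simp only [mul_sub, mul_one, Finset.sum_sub_distrib, ← sq] at key2
  linarith

theorem measureReal_atLeastTwo_le_sum_erase [Fintype ι] [DecidableEq ι] (i : ι) :
    P.real (atLeastTwo A) ≤ ∑ j ∈ Finset.univ.erase i, P.real (A j) := by
  refine (measureReal_mono ?_ (measure_ne_top _ _)).trans (measureReal_biUnion_finset_le _ _)
  rintro ω ⟨j, k, hjk, hj, hk⟩
  simp only [Finset.mem_erase, Finset.mem_univ, and_true, Set.mem_iUnion, exists_prop]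
  by_cases h : j = i
  · exact ⟨k, fun hki => hjk (h.trans hki.symm), hk⟩
  · exact ⟨j, h, hj⟩

end Pairwise

/-! ### The revenue as an integral over price levels. -/

theorem exists_arWins {n : ℕ} {r : ℝ} {b : Fin n → ℝ} (h : ∃ i, r ≤ b i) : ∃ i, arWins r b i := by
  classical
  obtain ⟨k, hk⟩ := h
  obtain ⟨m, -, hm⟩ := Finset.exists_max_image Finset.univ b ⟨k, Finset.mem_univ k⟩
  obtain ⟨i, hi, hmin⟩ := Finset.exists_min_image (Finset.univ.filter fun j => b j = b m) id
    ⟨m, by simp⟩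
  have him : b i = b m := by simpa using hi
  refine ⟨i, him ▸ hk.trans (hm k (Finset.mem_univ k)), fun j => ?_⟩
  rcases (hm j (Finset.mem_univ j)).lt_or_eq with hj | hj
  · exact Or.inl (him ▸ hj)
  · exact Or.inr ⟨hj.trans him.symm, hmin j (by simpa using hj)⟩

theorem arWins_unique {n : ℕ} {r : ℝ} {b : Fin n → ℝ} {i j : Fin n} (hi : arWins r b i)
    (hj : arWins r b j) : i = j := by
  rcases hi.2 j with h1 | ⟨h1, h1'⟩ <;> rcases hj.2 i with h2 | ⟨h2, h2'⟩
  · exact absurd h1 h2.not_gt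
  · exact absurd h2 h1.ne'
  · exact absurd h1 h2.ne'
  · exact le_antisymm h1' h2'

/-- When the item is sold at price `M`, the excess `M - r` is the length of the set of levels above
`r` that two bids exceed. -/
theorem ofReal_sum_arPayment {n : ℕ} {r : ℝ} (hr : 0 ≤ r) (b : Fin n → ℝ) :
    ENNReal.ofReal (∑ i, arPayment r b i) =
      (⋃ i, {v : Fin n → ℝ | r ≤ v i}).indicator (fun _ => ENNReal.ofReal r) b +
        volume {t | r < t ∧ b ∈ atLeastTwo fun (i : Fin n) => {v : Fin n → ℝ | t < v i}} := by
  classical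
  by_cases h : ∃ i, r ≤ b i
  · obtain ⟨i, hi⟩ := exists_arWins h
    have hsum : ∑ j, arPayment r b j = (Finset.univ.erase i).fold max r b := by
      rw [Finset.sum_eq_single i]
      · simp [arPayment, hi]
      · intro j _ hji
        rw [arPayment, if_neg fun hj => hji (arWins_unique hj hi)]
      · simp
    set M := (Finset.univ.erase i).fold max r b with hM
    have hrM : r ≤ M := (Finset.le_fold_max r).2 (Or.inl le_rfl)
    have hset : {t | r < t ∧ b ∈ atLeastTwo fun (i : Fin n) => {v : Fin n → ℝ | t < v i}} =
        Set.Ioo r M := by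
      ext t
      simp only [atLeastTwo, Set.mem_ofPred_eq, Set.mem_Ioo]
      refine and_congr_right fun hrt => ?_
      rw [hM, Finset.lt_fold_max]
      constructor
      · rintro ⟨j, k, hjk, hj, hk⟩
        right
        by_cases hji : j = i
        · exact ⟨k, by simpa using fun hki => hjk (hji.trans hki.symm), hk⟩
        · exact ⟨j, by simpa using hji, hj⟩
      · rintro (hlt | ⟨j, hj, hjt⟩)
        · exact absurd hrt hlt.not_gt
        · refine ⟨j, i, Finset.ne_of_mem_erase hj, hjt, ?_⟩
          rcases hi.2 j with h1 | ⟨h1, -⟩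
          · exact hjt.trans h1
          · exact h1 ▸ hjt
    rw [hset, Real.volume_Ioo, Set.indicator_of_mem (Set.mem_iUnion.2 h), hsum,
      ← ENNReal.ofReal_add hr (sub_nonneg.2 hrM), add_sub_cancel]
  · have hsum : ∑ j, arPayment r b j = 0 := Finset.sum_eq_zero fun j _ => by
      rw [arPayment, if_neg fun hj => h ⟨j, hj.1⟩]
    have hset : {t | r < t ∧ b ∈ atLeastTwo fun (i : Fin n) => {v : Fin n → ℝ | t < v i}} = ∅ := by
      rw [Set.eq_empty_iff_forall_notMem]
      rintro t ⟨ht, j, -, -, hj, -⟩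
      exact h ⟨j, ht.le.trans (le_of_lt hj)⟩
    rw [hset, Set.indicator_of_notMem (fun hm => h (Set.mem_iUnion.1 hm)), hsum]
    simp

theorem expectedRevenue_arPayment {n : ℕ} {r : ℝ} (hr : 0 ≤ r) (F : Measure (Fin n → ℝ))
    [SFinite F] :
    expectedRevenue (arPayment r) F =
      ENNReal.ofReal r * F (⋃ i, {v | r ≤ v i}) +
        ∫⁻ t in Set.Ioi r, F (atLeastTwo fun (i : Fin n) => {v : Fin n → ℝ | t < v i}) := by
  have hU : MeasurableSet (⋃ i, {v : Fin n → ℝ | r ≤ v i}) :=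
    MeasurableSet.iUnion fun i => measurableSet_le measurable_const (measurable_pi_apply i)
  have hE : MeasurableSet {x : (Fin n → ℝ) × ℝ | r < x.2 ∧
      x.1 ∈ atLeastTwo fun (i : Fin n) => {v : Fin n → ℝ | x.2 < v i}} := by
    have h2 : MeasurableSet
        (atLeastTwo fun (i : Fin n) => {x : (Fin n → ℝ) × ℝ | x.2 < x.1 i}) :=
      measurableSet_atLeastTwo fun i => measurableSet_lt measurable_snd
        ((measurable_pi_apply i).comp measurable_fst)
    exact (measurableSet_lt measurable_const measurable_snd).inter h2
  simp only [expectedRevenue, ofReal_sum_arPayment hr]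
  rw [lintegral_add_left (measurable_const.indicator hU), lintegral_indicator_const hU]
  congr 1
  -- Tonelli exchanges the length of the level set with the expectation.
  have h1 := Measure.prod_apply (μ := F) (ν := (volume : Measure ℝ)) hE
  rw [Measure.prod_apply_symm hE] at h1
  refine h1.symm.trans ?_
  rw [← lintegral_indicator measurableSet_Ioi]
  refine lintegral_congr fun t => ?_
  by_cases ht : r < t
  · rw [Set.indicator_of_mem (show t ∈ Set.Ioi r from ht)]
    congr 1
    ext v
    simp [ht]
  · rw [Set.indicator_of_notMem (show t ∉ Set.Ioi r from ht)]
    have : (fun v : Fin n → ℝ => (v, t)) ⁻¹' {x : (Fin n → ℝ) × ℝ | r < x.2 ∧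
      x.1 ∈ atLeastTwo fun (i : Fin n) => {v : Fin n → ℝ | x.2 < v i}} = ∅ := by
      ext v
      simp [ht]
    rw [this, measure_empty]

/-! ### Marginal tails and the revenue from high levels. -/

theorem sq_sum_sub_sum_sq {ι : Type*} [Fintype ι] [DecidableEq ι] (x : ι → ℝ) :
    (∑ i, x i) ^ 2 - ∑ i, x i ^ 2 = ∑ i, x i * ∑ j ∈ Finset.univ.erase i, x j := by
  rw [sq, Finset.sum_mul, ← Finset.sum_sub_distrib]
  refine Finset.sum_congr rfl fun i _ => ?_
  rw [← Finset.add_sum_erase _ _ (Finset.mem_univ i)]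
  ring

theorem sq_sum_sub_sum_sq_mono {ι : Type*} [Fintype ι] {x y : ι → ℝ} (h0 : ∀ i, 0 ≤ x i)
    (h : ∀ i, x i ≤ y i) :
    (∑ i, x i) ^ 2 - ∑ i, x i ^ 2 ≤ (∑ i, y i) ^ 2 - ∑ i, y i ^ 2 := by
  classical
  rw [sq_sum_sub_sum_sq, sq_sum_sub_sum_sq]
  refine Finset.sum_le_sum fun i _ => mul_le_mul (h i) (Finset.sum_le_sum fun j _ => h j)
    (Finset.sum_nonneg fun j _ => h0 j) ((h0 i).trans (h i))

section Priors

variable {n : ℕ} {D : Fin n → Measure ℝ} {F : Measure (Fin n → ℝ)}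

theorem measureReal_coord_mem (hF : F ∈ pairwiseIndepPriors D) {B : Set ℝ} (hB : MeasurableSet B)
    (i : Fin n) : F.real {v | v i ∈ B} = (D i).real B := by
  rw [← hF.2.1 i, map_measureReal_apply (measurable_pi_apply i) hB]
  rfl

theorem measureReal_coord_mem_inter (hF : F ∈ pairwiseIndepPriors D) {B : Set ℝ}
    (hB : MeasurableSet B) (i j : Fin n) (hij : i ≠ j) :
    F.real ({v | v i ∈ B} ∩ {v | v j ∈ B}) = F.real {v | v i ∈ B} * F.real {v | v j ∈ B} := by
  have := (hF.2.2 i j hij).measure_inter_preimage_eq_mul B B hB hB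
  simp only [measureReal_def, ← ENNReal.toReal_mul]
  exact congrArg ENNReal.toReal this

theorem pi_mem_pairwiseIndepPriors (D : Fin n → Measure ℝ) [∀ i, IsProbabilityMeasure (D i)] :
    Measure.pi D ∈ pairwiseIndepPriors D := by
  refine ⟨inferInstance, fun i => (measurePreserving_eval D i).map_eq, fun i j hij => ?_⟩
  exact (iIndepFun_pi (μ := D) (X := fun _ => id) fun _ => aemeasurable_id).indepFun hij

/-- Twice the expected number of pairs of values above `t`. -/
noncomputable def tailPairs (D : Fin n → Measure ℝ) (t : ℝ) : ℝ :=
  (∑ i, (D i).real (Set.Ioi t)) ^ 2 - ∑ i, (D i).real (Set.Ioi t) ^ 2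

theorem tailPairs_nonneg (D : Fin n → Measure ℝ) (t : ℝ) : 0 ≤ tailPairs D t := by
  classical
  rw [tailPairs, sq_sum_sub_sum_sq]
  exact Finset.sum_nonneg fun i _ => mul_nonneg measureReal_nonneg
    (Finset.sum_nonneg fun j _ => measureReal_nonneg)

/-- Both tails in a pair shrink by `2p/(p + t)`, so the integrand is at most `2p²τ/(p + t)²`, whose
integral over `t > p` is exactly `pτ`. -/
theorem lintegral_atLeastTwo_tail_le [∀ i, IsProbabilityMeasure (D i)]
    (hD_nonneg : ∀ i, ∀ᵐ v ∂(D i), 0 ≤ v) (hD_regular : ∀ i, IsRegularDistribution (D i))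
    (hF : F ∈ pairwiseIndepPriors D) {p : ℝ} (hp : 0 ≤ p)
    (hhalf : ∀ i, (D i).real (Set.Ioi p) ≤ 1 / 2) :
    ∫⁻ t in Set.Ioi p, F (atLeastTwo fun (i : Fin n) => {v : Fin n → ℝ | t < v i}) ≤
      ENNReal.ofReal (p * tailPairs D p) := by
  have := hF.1
  set τ := tailPairs D p with hτ
  have hτ0 : 0 ≤ τ := tailPairs_nonneg D p
  have hpt : ∀ t ∈ Set.Ioi p,
      F (atLeastTwo fun (i : Fin n) => {v : Fin n → ℝ | t < v i}) ≤
        ENNReal.ofReal (2 * p ^ 2 * τ / (p + t) ^ 2) := by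
    intro t ht
    rw [← ofReal_measureReal]
    refine ENNReal.ofReal_le_ofReal ?_
    have h1 := two_mul_measureReal_atLeastTwo_le (P := F)
      (A := fun (i : Fin n) => {v : Fin n → ℝ | t < v i})
      (fun i => measurableSet_lt measurable_const (measurable_pi_apply i))
      (measureReal_coord_mem_inter hF (B := Set.Ioi t) measurableSet_Ioi)
    have h2 : ∀ i, F.real {v : Fin n → ℝ | t < v i} = (D i).real (Set.Ioi t) :=
      measureReal_coord_mem hF measurableSet_Ioi
    simp only [h2] at h1
    have h3 := h1.trans (sq_sum_sub_sum_sq_mono (fun i => measureReal_nonneg) fun i =>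
      (hD_regular i).tail_le (hD_nonneg i) hp ht (hhalf i))
    simp only [← Finset.mul_sum, mul_pow] at h3
    rw [← mul_sub] at h3
    change _ ≤ _ * τ at h3
    calc _ ≤ (2 * p / (p + t)) ^ 2 * τ / 2 := by linarith
      _ = _ := by rw [div_pow]; ring
  refine (setLIntegral_mono' measurableSet_Ioi hpt).trans ?_
  -- At `p = 0` the bound vanishes, while the antiderivative below would be singular at `t = p`.
  rcases hp.eq_or_lt with rfl | hp0
  · simp
  have hderiv : ∀ t ∈ Set.Ici p, HasDerivAt (fun t => -(2 * p ^ 2 * τ) / (p + t))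
      (2 * p ^ 2 * τ / (p + t) ^ 2) t := by
    intro t ht
    have hne : p + t ≠ 0 := by
      have : p ≤ t := ht
      linarith
    refine ((hasDerivAt_const t (-(2 * p ^ 2 * τ))).div
      ((hasDerivAt_id t).const_add p) hne).congr_deriv ?_
    simp
  have hpos : ∀ t ∈ Set.Ioi p, 0 ≤ 2 * p ^ 2 * τ / (p + t) ^ 2 := fun t _ => by positivity
  have hlim : Filter.Tendsto (fun t => -(2 * p ^ 2 * τ) / (p + t)) Filter.atTop (nhds 0) :=
    (Filter.tendsto_atTop_add_const_left _ p Filter.tendsto_id).const_div_atTop _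
  rw [← ofReal_integral_eq_lintegral_ofReal
    (integrableOn_Ioi_deriv_of_nonneg' hderiv hpos hlim)
    ((ae_restrict_iff' measurableSet_Ioi).2 (Filter.Eventually.of_forall hpos)),
    integral_Ioi_of_hasDerivAt_of_nonneg' hderiv hpos hlim]
  refine ENNReal.ofReal_le_ofReal (le_of_eq ?_)
  field_simp
  ring

/-! ### Comparing two priors at a single level. -/

/-- Beyond `t`, every value has upper tail probability at most `1/2`, and the expected number of
values above `t` is at most `2`. -/
def SmallTail (D : Fin n → Measure ℝ) (t : ℝ) : Prop :=
  (∀ i, (D i).real (Set.Ioi t) ≤ 1 / 2) ∧ ∑ i, (D i).real (Set.Ioi t) ≤ 2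

theorem SmallTail.mono [∀ i, IsProbabilityMeasure (D i)] {s t : ℝ} (h : SmallTail D s)
    (hst : s ≤ t) : SmallTail D t :=
  ⟨fun i => (measureReal_mono (Set.Ioi_subset_Ioi hst)).trans (h.1 i),
    (Finset.sum_le_sum fun _ _ => measureReal_mono (Set.Ioi_subset_Ioi hst)).trans h.2⟩

theorem tailPairs_le_sq (D : Fin n → Measure ℝ) (t : ℝ) :
    tailPairs D t ≤ (∑ i, (D i).real (Set.Ioi t)) ^ 2 :=
  sub_le_self _ (Finset.sum_nonneg fun _ _ => sq_nonneg _)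

theorem SmallTail.tailPairs_le_four {t : ℝ} (h : SmallTail D t) : tailPairs D t ≤ 4 := by
  have h0 : 0 ≤ ∑ i, (D i).real (Set.Ioi t) := Finset.sum_nonneg fun _ _ => measureReal_nonneg
  nlinarith [tailPairs_le_sq D t, h.2]

theorem SmallTail.tailPairs_le {t : ℝ} (h : SmallTail D t) (i : Fin n) :
    tailPairs D t ≤ ∑ j ∈ Finset.univ.erase i, (D j).real (Set.Ioi t) +
      (∑ j ∈ Finset.univ.erase i, (D j).real (Set.Ioi t)) ^ 2 := by
  have h1 : (D i).real (Set.Ioi t) ^ 2 ≤ ∑ i, (D i).real (Set.Ioi t) ^ 2 :=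
    Finset.single_le_sum (f := fun i => (D i).real (Set.Ioi t) ^ 2) (fun _ _ => sq_nonneg _)
      (Finset.mem_univ i)
  have h0 : 0 ≤ ∑ j ∈ Finset.univ.erase i, (D j).real (Set.Ioi t) :=
    Finset.sum_nonneg fun _ _ => measureReal_nonneg
  rw [tailPairs, ← Finset.add_sum_erase _ (fun i => (D i).real (Set.Ioi t)) (Finset.mem_univ i)]
  nlinarith [h.1 i]

/-- The arithmetic behind `18`: `x` and `f` are the two priors' probabilities at `t`, while `w` and
`u` are the tail sums without the likely bidder at `t` and at `T`. Both cases are tight at `u = w =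
1`, `x = 1`, `τ = 2`, where `f` may be `1/6`. -/
theorem le_of_mul_two_add_four {x u w τ f : ℝ} (hf : 0 ≤ f) (hu : 0 ≤ u) (huw : u ≤ w)
    (hτ : τ ≤ u + u ^ 2) (hu2 : u ≤ 2) (hx1 : x ≤ 1) (hxw : x ≤ w)
    (h1 : w ≤ f * (2 + 4 * w))
    (h2 : 1 ≤ w → (w - 1 / 2) ^ 2 ≤ f * (w ^ 2 + 1 / 2)) : x + τ ≤ 18 * f := by
  rcases le_or_gt u 1 with hu1 | hu1
  · rcases hu.eq_or_lt with rfl | hu0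
    · have : x ≤ 6 * f := by
        rcases le_or_gt w 1 with hw | hw
        · nlinarith
        · have : 1 ≤ 6 * f := by
            by_contra hcon
            nlinarith
          linarith
      linarith
    · have hw0 : 0 < w := hu0.trans_le huw
      have h3 : (x + τ) * (2 + 4 * w) ≤ 18 * w := by
        rcases le_or_gt w 1 with hw | hw
        · have : τ ≤ 2 * u := by nlinarith
          nlinarith
        · have : x + τ ≤ 3 := by nlinarith
          nlinarith
      have h4 : (x + τ) * (2 + 4 * w) ≤ 18 * f * (2 + 4 * w) := by linarith
      exact le_of_mul_le_mul_right h4 (by linarith)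
  · have h3 := h2 (by linarith)
    have h4 : x + τ ≤ 1 + u + u ^ 2 := by linarith
    have h5 : (1 + u + u ^ 2) * (w ^ 2 + 1 / 2) ≤ 18 * (w - 1 / 2) ^ 2 := by
      have hA : (1 + u + u ^ 2) * (u ^ 2 + 1 / 2) ≤ 18 * (u - 1 / 2) ^ 2 := by
        have : 0 ≤ (u - 1) * (-u ^ 3 - 2 * u ^ 2 + 29 / 2 * u - 4) := by
          refine mul_nonneg (by linarith) ?_
          nlinarith [mul_nonneg (sub_nonneg.2 hu1.le) (sub_nonneg.2 hu2), mul_nonneg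
            (mul_nonneg (sub_nonneg.2 hu1.le) (sub_nonneg.2 hu2)) hu]
        nlinarith
      have hB : (w ^ 2 + 1 / 2) * (u - 1 / 2) ^ 2 ≤ (u ^ 2 + 1 / 2) * (w - 1 / 2) ^ 2 := by
        nlinarith [mul_nonneg (sub_nonneg.2 huw) (mul_nonneg hu (by linarith : 0 ≤ w)),
          mul_nonneg (sub_nonneg.2 huw) (mul_nonneg (sub_nonneg.2 hu1.le)
          (show 0 ≤ w - 1 by linarith)), mul_nonneg (sub_nonneg.2 huw) hu]
      have hpos : 0 < (u - 1 / 2) ^ 2 := by nlinarith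
      have hC : (1 + u + u ^ 2) * (w ^ 2 + 1 / 2) * (u - 1 / 2) ^ 2 ≤
          18 * (w - 1 / 2) ^ 2 * (u - 1 / 2) ^ 2 := by
        calc _ = (1 + u + u ^ 2) * ((w ^ 2 + 1 / 2) * (u - 1 / 2) ^ 2) := by ring
          _ ≤ (1 + u + u ^ 2) * ((u ^ 2 + 1 / 2) * (w - 1 / 2) ^ 2) := by gcongr
          _ = ((1 + u + u ^ 2) * (u ^ 2 + 1 / 2)) * (w - 1 / 2) ^ 2 := by ring
          _ ≤ (18 * (u - 1 / 2) ^ 2) * (w - 1 / 2) ^ 2 := by gcongr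
          _ = _ := by ring
      exact le_of_mul_le_mul_right hC hpos
    have h6 : (x + τ) * (w ^ 2 + 1 / 2) ≤ 18 * f * (w ^ 2 + 1 / 2) := by nlinarith
    exact le_of_mul_le_mul_right h6 (by positivity)

variable {G : Measure (Fin n → ℝ)}

/-- `SmallTail` fails at `t` either through one value with tail above `1/2` or through a tail sum
above `2`. In the first case that bidder anchors the bounds; in the second Cantelli alone suffices.
-/
theorem measureReal_atLeastTwo_add_le [∀ i, IsProbabilityMeasure (D i)]
    (hF : F ∈ pairwiseIndepPriors D)
    (hG : G ∈ pairwiseIndepPriors D) {t T : ℝ} (htT : t ≤ T) (ht : ¬ SmallTail D t)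
    (hT : SmallTail D T) :
    G.real (atLeastTwo fun (i : Fin n) => {v : Fin n → ℝ | t < v i}) + tailPairs D T ≤
      18 * F.real (atLeastTwo fun (i : Fin n) => {v : Fin n → ℝ | t < v i}) := by
  have := hF.1
  have := hG.1
  set A := fun (i : Fin n) => {v : Fin n → ℝ | t < v i} with hAdef
  have hA : ∀ i, MeasurableSet (A i) :=
    fun i => measurableSet_lt measurable_const (measurable_pi_apply i)
  have hpair := measureReal_coord_mem_inter hF (B := Set.Ioi t) measurableSet_Ioi
  have hqF : ∀ i, F.real (A i) = (D i).real (Set.Ioi t) :=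
    measureReal_coord_mem hF measurableSet_Ioi
  have hqG : ∀ i, G.real (A i) = (D i).real (Set.Ioi t) :=
    measureReal_coord_mem hG measurableSet_Ioi
  have hG1 : G.real (atLeastTwo A) ≤ 1 := measureReal_le_one
  by_cases hS : ∑ i, (D i).real (Set.Ioi t) ≤ 2
  · obtain ⟨i, hi⟩ : ∃ i, 1 / 2 < (D i).real (Set.Ioi t) := by
      by_contra hcon
      push Not at hcon
      exact ht ⟨hcon, hS⟩
    set w := ∑ j ∈ Finset.univ.erase i, (D j).real (Set.Ioi t) with hw
    have hsum : ∑ j, (D j).real (Set.Ioi t) = (D i).real (Set.Ioi t) + w :=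
      (Finset.add_sum_erase _ _ (Finset.mem_univ i)).symm
    have h1 := mul_le_measureReal_atLeastTwo hA hpair i (by rw [hqF]; exact hi.le)
    have hxw := measureReal_atLeastTwo_le_sum_erase (P := G) (A := A) i
    simp only [hqF] at h1
    simp only [hqG] at hxw
    have huw : ∑ j ∈ Finset.univ.erase i, (D j).real (Set.Ioi T) ≤ w :=
      Finset.sum_le_sum fun _ _ => measureReal_mono (Set.Ioi_subset_Ioi htT)
    refine le_of_mul_two_add_four measureReal_nonneg
      (Finset.sum_nonneg fun _ _ => measureReal_nonneg) huw (hT.tailPairs_le i)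
      (by linarith) hG1 hxw h1 fun hw1 => ?_
    -- With `m = w - 1/2` this gives `V + m² = w² + 1/2`, the denominator in the numerical lemma.
    have hV : ∑ j, F.real (A j) * (1 - F.real (A j)) ≤ 1 / 4 + w := by
      rw [← Finset.add_sum_erase _ _ (Finset.mem_univ i)]
      simp only [hqF]
      refine add_le_add (by nlinarith [sq_nonneg ((D i).real (Set.Ioi t) - 1 / 2)])
        (Finset.sum_le_sum fun j _ => ?_)
      nlinarith [measureReal_nonneg (μ := D j) (s := Set.Ioi t)]
    have h2 := sq_le_measureReal_atLeastTwo hA hpair hV (m := w - 1 / 2) (by linarith)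
      (by simp only [hqF]; linarith)
    linarith
  · push Not at hS
    have hV : ∑ j, F.real (A j) * (1 - F.real (A j)) ≤ ∑ j, F.real (A j) :=
      Finset.sum_le_sum fun j _ => by nlinarith [measureReal_nonneg (μ := F) (s := A j)]
    have hSF : 2 < ∑ i, F.real (A i) := by simpa only [hqF] using hS
    have h2 := sq_le_measureReal_atLeastTwo hA hpair hV (by linarith) le_rfl
    have h4 := hT.tailPairs_le_four
    have h0 : 0 ≤ F.real (atLeastTwo A) := measureReal_nonneg
    set S := ∑ i, F.real (A i)
    -- `(S - 1)²/(S + (S - 1)²)` is at least its value `1/3` at `S = 2`; then `1 + 4 ≤ 18/3`.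
    have : 1 ≤ 3 * F.real (atLeastTwo A) := by
      have hpos : 0 < S + (S - 1) ^ 2 := by positivity
      refine le_of_mul_le_mul_right ?_ hpos
      nlinarith
    linarith

theorem one_add_tailPairs_le [∀ i, IsProbabilityMeasure (D i)]
    (hF : F ∈ pairwiseIndepPriors D) {r T : ℝ} (hr : ¬ SmallTail D r) (hT : SmallTail D T) :
    1 + tailPairs D T ≤ 18 * F.real (⋃ i, {v : Fin n → ℝ | r ≤ v i}) := by
  have := hF.1
  have h4 := hT.tailPairs_le_four
  suffices 1 / 2 ≤ F.real (⋃ i, {v : Fin n → ℝ | r ≤ v i}) by linarith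
  have hmono : F.real (⋃ i, {v : Fin n → ℝ | r < v i}) ≤
      F.real (⋃ i, {v : Fin n → ℝ | r ≤ v i}) :=
    measureReal_mono (Set.iUnion_mono fun i v (hv : r < v i) => hv.le)
  refine le_trans ?_ hmono
  have hq : ∀ i, F.real {v : Fin n → ℝ | r < v i} = (D i).real (Set.Ioi r) :=
    measureReal_coord_mem hF measurableSet_Ioi
  by_cases hS : ∑ i, (D i).real (Set.Ioi r) ≤ 2
  · obtain ⟨i, hi⟩ : ∃ i, 1 / 2 < (D i).real (Set.Ioi r) := by
      by_contra hcon
      push Not at hcon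
      exact hr ⟨hcon, hS⟩
    rw [← hq] at hi
    exact hi.le.trans (measureReal_mono
      (Set.subset_iUnion (fun i => {v : Fin n → ℝ | r < v i}) i))
  · push Not at hS
    have h := sum_le_measureReal_iUnion (P := F)
      (A := fun (i : Fin n) => {v : Fin n → ℝ | r < v i})
      (fun i => measurableSet_lt measurable_const (measurable_pi_apply i))
      (measureReal_coord_mem_inter hF (B := Set.Ioi r) measurableSet_Ioi)
    simp only [hq] at h
    nlinarith

theorem SmallTail.measureReal_iUnion_add_le [∀ i, IsProbabilityMeasure (D i)]
    (hF : F ∈ pairwiseIndepPriors D) (hG : G ∈ pairwiseIndepPriors D) {r : ℝ}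
    (hr : SmallTail D r) :
    G.real (⋃ i, {v : Fin n → ℝ | r ≤ v i}) + tailPairs D r ≤
      18 * F.real (⋃ i, {v : Fin n → ℝ | r ≤ v i}) := by
  have := hF.1
  have := hG.1
  have h1 := sum_le_measureReal_iUnion (P := F)
    (A := fun (i : Fin n) => {v : Fin n → ℝ | r ≤ v i})
    (fun i => measurableSet_le measurable_const (measurable_pi_apply i))
    (measureReal_coord_mem_inter hF (B := Set.Ici r) measurableSet_Ici)
  have h2 := measureReal_iUnion_fintype_le (μ := G)
    (fun (i : Fin n) => {v : Fin n → ℝ | r ≤ v i})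
  have hqF : ∀ i, F.real {v : Fin n → ℝ | r ≤ v i} = (D i).real (Set.Ici r) :=
    measureReal_coord_mem hF measurableSet_Ici
  have hqG : ∀ i, G.real {v : Fin n → ℝ | r ≤ v i} = (D i).real (Set.Ici r) :=
    measureReal_coord_mem hG measurableSet_Ici
  simp only [hqF] at h1
  simp only [hqG] at h2
  have hSW : ∑ i, (D i).real (Set.Ioi r) ≤ ∑ i, (D i).real (Set.Ici r) :=
    Finset.sum_le_sum fun _ _ => measureReal_mono Set.Ioi_subset_Ici_self
  have hS0 : 0 ≤ ∑ i, (D i).real (Set.Ioi r) := Finset.sum_nonneg fun _ _ => measureReal_nonneg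
  have hS2 := hr.2
  have hτ := tailPairs_le_sq D r
  have hG1 : G.real (⋃ i, {v : Fin n → ℝ | r ≤ v i}) ≤ 1 := measureReal_le_one
  set S := ∑ i, (D i).real (Set.Ioi r)
  set W := ∑ i, (D i).real (Set.Ici r)
  set x := G.real (⋃ i, {v : Fin n → ℝ | r ≤ v i})
  set f := F.real (⋃ i, {v : Fin n → ℝ | r ≤ v i})
  -- `hx` uses `x ≤ min(1, W)` and `hS` uses `S ≤ min(2, W)`; together they give the factor `8`,
  -- well below `18`.
  have hx : x * (1 + W) ≤ 2 * W := by
    rcases le_total W 1 with hW | hW <;> nlinarith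
  have hS : S ^ 2 * (1 + W) ≤ 6 * W := by
    have h3 : S ^ 2 ≤ 2 * W := by nlinarith
    have h4 : S ^ 2 ≤ 4 := by nlinarith
    nlinarith
  have hW1 : 0 < 1 + W := by linarith
  refine le_of_mul_le_mul_right ?_ hW1
  nlinarith

/-! ### The threshold level and the final charging argument. -/

theorem exists_smallTail_forall_lt_not [∀ i, IsProbabilityMeasure (D i)] {r : ℝ}
    (hr : ¬ SmallTail D r) :
    ∃ T, r ≤ T ∧ SmallTail D T ∧ ∀ t < T, ¬ SmallTail D t := by
  have hc : ∀ i x, (D i).real (Set.Ioi x) = 1 - cdf (D i) x := fun i x => by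
    rw [cdf_eq_real, ← Set.compl_Iic, probReal_compl_eq_one_sub measurableSet_Iic]
  have hlim : ∀ i, Filter.Tendsto (fun t => (D i).real (Set.Ioi t)) Filter.atTop (nhds 0) := by
    intro i
    simp only [hc]
    simpa using (tendsto_cdf_atTop (D i)).const_sub 1
  have hev : ∀ᶠ t in Filter.atTop, SmallTail D t := by
    refine Filter.Eventually.and ?_ ?_
    · exact Filter.eventually_all.2 fun i => (hlim i).eventually_le_const (by norm_num)
    · have := tendsto_finsetSum Finset.univ fun i (_ : i ∈ Finset.univ) => hlim i
      rw [Finset.sum_const_zero] at this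
      exact this.eventually_le_const (by norm_num)
  obtain ⟨M, hM⟩ := hev.exists
  have hbdd : BddAbove {t | ¬ SmallTail D t} :=
    ⟨M, fun t ht => le_of_not_ge fun hMt => ht (hM.mono hMt)⟩
  set T := sSup {t | ¬ SmallTail D t} with hT
  have hgt : ∀ t ∈ Set.Ioi T, SmallTail D t := fun t ht => by
    by_contra hcon
    exact notMem_of_csSup_lt ht hbdd hcon
  -- Right-continuity of the tails passes `SmallTail` from all levels above the supremum to `T`
  -- itself.
  have hright : ∀ i, Filter.Tendsto (fun t => (D i).real (Set.Ioi t)) (nhdsWithin T (Set.Ioi T))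
      (nhds ((D i).real (Set.Ioi T))) := by
    intro i
    simp only [hc]
    exact (((cdf (D i)).right_continuous T).mono_left
      (nhdsWithin_mono T Set.Ioi_subset_Ici_self)).const_sub 1
  refine ⟨T, le_csSup hbdd hr, ⟨fun i => ?_, ?_⟩, fun t ht => ?_⟩
  · exact le_of_tendsto (hright i) (eventually_mem_nhdsWithin.mono fun t ht => (hgt t ht).1 i)
  · exact le_of_tendsto (tendsto_finsetSum Finset.univ fun i (_ : i ∈ Finset.univ) => hright i)
      (eventually_mem_nhdsWithin.mono fun t ht => (hgt t ht).2)
  · obtain ⟨a, ha, hta⟩ := exists_lt_of_lt_csSup ⟨r, hr⟩ ht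
    exact fun h => ha (h.mono hta.le)

/-- The anonymous-reserve revenues of two pairwise independent priors with the same regular
marginals differ by a factor of at most `18`. -/
theorem expectedRevenue_arPayment_le [∀ i, IsProbabilityMeasure (D i)]
    (hD_nonneg : ∀ i, ∀ᵐ v ∂(D i), 0 ≤ v) (hD_regular : ∀ i, IsRegularDistribution (D i))
    {r : ℝ} (hr : 0 ≤ r) (hF : F ∈ pairwiseIndepPriors D) (hG : G ∈ pairwiseIndepPriors D) :
    expectedRevenue (arPayment r) G ≤ 18 * expectedRevenue (arPayment r) F := by
  have := hF.1
  have := hG.1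
  have h18 : ENNReal.ofReal 18 = 18 := by simp
  have lift : ∀ {U : Set (Fin n → ℝ)} {x τ : ℝ}, 0 ≤ x → 0 ≤ τ → x + τ ≤ 18 * F.real U →
      ENNReal.ofReal x + ENNReal.ofReal τ ≤ 18 * F U := by
    intro U x τ hx hτ h
    rw [← ENNReal.ofReal_add hx hτ, ← ofReal_measureReal (μ := F) (s := U), ← h18,
      ← ENNReal.ofReal_mul (by norm_num)]
    exact ENNReal.ofReal_le_ofReal h
  rw [expectedRevenue_arPayment hr, expectedRevenue_arPayment hr]
  set B := fun t : ℝ => atLeastTwo fun (i : Fin n) => {v : Fin n → ℝ | t < v i}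
  set U := ⋃ i, {v : Fin n → ℝ | r ≤ v i}
  by_cases hgood : SmallTail D r
  · have htail := lintegral_atLeastTwo_tail_le hD_nonneg hD_regular hG hr hgood.1
    have hU := lift measureReal_nonneg (tailPairs_nonneg D r)
      (hgood.measureReal_iUnion_add_le hF hG)
    rw [ofReal_measureReal] at hU
    calc _ ≤ ENNReal.ofReal r * G U + ENNReal.ofReal (r * tailPairs D r) := by gcongr
      _ = ENNReal.ofReal r * (G U + ENNReal.ofReal (tailPairs D r)) := by
        rw [ENNReal.ofReal_mul hr, mul_add]
      _ ≤ ENNReal.ofReal r * (18 * F U) := by gcongr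
      _ = 18 * (ENNReal.ofReal r * F U) := by ring
      _ ≤ _ := by gcongr; exact le_self_add
  · obtain ⟨T, hrT, hT, hlt⟩ := exists_smallTail_forall_lt_not hgood
    have hT0 := hr.trans hrT
    have hτ0 := tailPairs_nonneg D T
    have htail := lintegral_atLeastTwo_tail_le hD_nonneg hD_regular hG hT0 hT.1
    have hU : G U + ENNReal.ofReal (tailPairs D T) ≤ 18 * F U := by
      refine le_trans ?_ (lift zero_le_one hτ0 (one_add_tailPairs_le hF hgood hT))
      gcongr
      simpa using prob_le_one
    have hB : ∀ t ∈ Set.Ioo r T, G (B t) + ENNReal.ofReal (tailPairs D T) ≤ 18 * F (B t) := by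
      intro t ht
      have := lift measureReal_nonneg hτ0
        (measureReal_atLeastTwo_add_le hF hG ht.2.le (hlt t ht.2) hT)
      rwa [ofReal_measureReal] at this
    have hsplit : ∫⁻ t in Set.Ioi r, G (B t) ≤
        (∫⁻ t in Set.Ioo r T, G (B t)) + ENNReal.ofReal (T * tailPairs D T) := by
      calc _ ≤ ∫⁻ t in Set.Ioo r T ∪ Set.Ici T, G (B t) := lintegral_mono_set fun t ht =>
            (lt_or_ge t T).imp (fun h => ⟨ht, h⟩) id
        _ ≤ (∫⁻ t in Set.Ioo r T, G (B t)) + ∫⁻ t in Set.Ici T, G (B t) := lintegral_union_le _ _ _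
        _ = (∫⁻ t in Set.Ioo r T, G (B t)) + ∫⁻ t in Set.Ioi T, G (B t) := by
            rw [setLIntegral_congr Ioi_ae_eq_Ici]
        _ ≤ _ := by gcongr
    -- The charging step: the bound on levels above `T` is split between the reserve term and the
    -- levels in `(r, T)`.
    have hconst : ENNReal.ofReal (T * tailPairs D T) =
        ENNReal.ofReal r * ENNReal.ofReal (tailPairs D T) +
          ∫⁻ _ in Set.Ioo r T, ENNReal.ofReal (tailPairs D T) := by
      rw [setLIntegral_const, Real.volume_Ioo, mul_comm (ENNReal.ofReal (tailPairs D T)),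
        ← add_mul, ← ENNReal.ofReal_add hr (sub_nonneg.2 hrT), add_sub_cancel,
        ENNReal.ofReal_mul hT0]
    calc _ ≤ ENNReal.ofReal r * G U + ((∫⁻ t in Set.Ioo r T, G (B t)) +
          ENNReal.ofReal (T * tailPairs D T)) := by gcongr
      _ = ENNReal.ofReal r * (G U + ENNReal.ofReal (tailPairs D T)) +
          ∫⁻ t in Set.Ioo r T, (G (B t) + ENNReal.ofReal (tailPairs D T)) := by
        rw [hconst, lintegral_add_right _ measurable_const]
        ring
      _ ≤ ENNReal.ofReal r * (18 * F U) + ∫⁻ t in Set.Ioo r T, 18 * F (B t) := by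
        gcongr ?_ + ?_
        · gcongr
        · exact setLIntegral_mono' measurableSet_Ioo hB
      _ = 18 * (ENNReal.ofReal r * F U + ∫⁻ t in Set.Ioo r T, F (B t)) := by
        rw [lintegral_const_mul' _ _ (by simp)]
        ring
      _ ≤ _ := by
        gcongr
        exact Set.Ioo_subset_Ioi_self

end Priors

theorem mainTheorem4 (n : ℕ) (D : Fin n → MeasureTheory.Measure ℝ)
    [∀ i, MeasureTheory.IsProbabilityMeasure (D i)]
    (hD_nonneg : ∀ i, ∀ᵐ v ∂(D i), 0 ≤ v)
    (hD_regular : ∀ i, IsRegularDistribution (D i))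
    (r : ℝ) (hr : 0 ≤ r) :
    IsPairwiseRobustWith D (arPayment r) 18.07 := by
  intro F hF
  refine (expectedRevenue_arPayment_le hD_nonneg hD_regular hr hF
    (pi_mem_pairwiseIndepPriors D)).trans ?_
  gcongr
  have : (18 : NNReal) ≤ 18.07 := by
    rw [← NNReal.coe_le_coe]
    norm_num
  exact_mod_cast this
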